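/- Proposition 3.1. For a non-empty set $A \subseteq \mathbb{R}^d$, the dimension $\dim(A)$ is the dimension of the affine subspace spanned by $A$, and $A - A = \{a - b : a, b \in A\}$. Let $d$ be a natural number and let $l_1, \dots, l_r$ be $r$ parallel lines in $\mathbb{R}^d$. Suppose that $A$ is a finite, non-empty subset of $\mathbb{R}^d$ with $\dim(A) = d$ such that $$A \subseteq l_1 \cup l_2 \cup \dots \cup l_r \quad\text{and}\quad |A \cap l_i| \geq 2d^2 \quad (1 \leq i \leq r).$$ Then $$|A - A| \geq (2d-2)|A| - K_d\, r, \qquad \text{where } K_d = 1000 d^3.$$ -/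

import Mathlib

open scoped Pointwise

/-- The dimension of a set `A ⊆ ℝ^d`: the dimension of the affine subspace spanned by `A`. -/
noncomputable def affDim {d : ℕ} (A : Set (EuclideanSpace ℝ (Fin d))) : ℕ :=
  Module.finrank ℝ (affineSpan ℝ A).direction

/-- A line in `ℝ^d`: a one-dimensional affine subspace. (The empty affine subspace has
zero-dimensional direction, so it is not a line.) -/
def IsLine {d : ℕ} (l : AffineSubspace ℝ (EuclideanSpace ℝ (Fin d))) : Prop :=
  Module.finrank ℝ l.direction = 1

/-!
Let `X` be the projection of `A` along the common direction of the lines, a set of dimension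
`k = d - 1` with at most `r` points, and let `a x` be the number of points of `A` over `x ∈ X`. By
Cauchy–Davenport the fibre of `A - A` over `x - y` has at least `a x + a y - 1` points. Slice the
weights into the level sets `L t = {x ∈ X | t ≤ a x}`. It suffices that each level contributes
`2 k |L t|` to the total size of the fibres, up to a bounded number of levels, as
`∑ t, |L t| = |A|`.

If `L t` has dimension `k_t`, the differences in `L t - L t` count twice, for at least
`2 k_t |L t|` in all, provided that `|Z - Z| ≥ (dim Z) |Z|` for every finite set `Z`. The missing
`2 (k - k_t) |L t|` come from the differences `±(x - y)` with `x ∈ L t` and `y` one of the `k - k_t`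
elements outside `L t` of an affine basis of `X`. The basis is chosen greedily by decreasing weight
(`exists_linearIndepOn_greedy`), and this makes the contributions of different levels compatible
(`sum_indicator_le`, `weighted_card_le`).

The inequality `|A - A| ≥ (dim A) |A| + 1` for arbitrary finite sets
(`spanDim_mul_card_lt_card_sub`) is proved by induction on the dimension, from the same weighted
bound. If two parallel lines each contain at least two points of `A`, project along them. The
differences between `X` and the set `L 2` of heavy lines are numerous enough
(`card_sub_union_sub_ge`) to give the bound with nothing lost. If no two such lines exist, every
difference has all its representations on a single line and a double count suffices
(`spanDim_mul_card_lt_of_lines`).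
-/

section DifferenceSets

open scoped Classical

/-! ### Dimension and cardinality of finite sets -/

variable {E : Type*} [AddCommGroup E] [Module ℝ E]

/-- The dimension of the affine span of a finite set `s`, as the rank of the direction of that
span. It is `0` when `s` is empty. -/
noncomputable def spanDim (s : Finset E) : ℕ := Module.finrank ℝ (vectorSpan ℝ (s : Set E))

theorem vectorSpan_eq_span_image_sub {s : Set E} {z : E} (hz : z ∈ s) :
    vectorSpan ℝ s = Submodule.span ℝ ((fun x => x - z) '' s) := by
  simpa using vectorSpan_eq_span_vsub_set_right ℝ hz

/-- The Cauchy–Davenport inequality in a real vector space, for differences. -/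
theorem card_add_card_le_card_sub_add_one {s t : Finset E} (hs : s.Nonempty) (ht : t.Nonempty) :
    s.card + t.card ≤ (s - t).card + 1 := by
  have : IsAddTorsionFree E := .of_isTorsionFree ℝ E
  have h := cauchy_davenport_of_isAddTorsionFree hs ht.neg
  rw [← sub_eq_add_neg, Finset.card_neg] at h
  omega

theorem LinearIndepOn.add_ne_zero {ι : Type*} {g : ι → E} {s : Set ι}
    (h : LinearIndepOn ℝ g s) {i j : ι} (hi : i ∈ s) (hj : j ∈ s) : g i + g j ≠ 0 := by
  intro h0
  by_cases hij : i = j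
  · subst hij
    rw [← two_smul ℝ, smul_eq_zero_iff_right two_ne_zero] at h0
    exact h.ne_zero hi h0
  · have := (LinearIndepOn.pair_iff g hij).1 (h.mono (Set.insert_subset hi (by simpa using hj))) 1 1
      (by simpa using h0)
    exact one_ne_zero this.1

theorem finrank_map_mkQ_add {W U : Submodule ℝ E} [FiniteDimensional ℝ U] (h : W ≤ U) :
    Module.finrank ℝ (U.map W.mkQ) + Module.finrank ℝ W = Module.finrank ℝ U := by
  have h1 := LinearMap.finrank_range_add_finrank_ker (W.mkQ.domRestrict U)
  have h2 : LinearMap.range (W.mkQ.domRestrict U) = U.map W.mkQ := by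
    rw [LinearMap.domRestrict, LinearMap.range_comp, Submodule.range_subtype]
  have h3 : LinearMap.ker (W.mkQ.domRestrict U) = W.comap U.subtype := by
    rw [LinearMap.domRestrict, LinearMap.ker_comp, Submodule.ker_mkQ]
  rw [h2, h3, (Submodule.comapSubtypeEquivOfLe h).finrank_eq] at h1
  exact h1

/-- A spanning set contains a basis `b`, and `b`, `-b`, `{0}` are pairwise disjoint. -/
theorem two_mul_finrank_span_lt_card_union_neg {Q : Finset E} (h0 : (0 : E) ∈ Q) :
    2 * Module.finrank ℝ (Submodule.span ℝ (Q : Set E)) + 1 ≤ (Q ∪ -Q).card := by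
  obtain ⟨b, hbQ, hspan, hb⟩ := exists_linearIndependent ℝ (Q : Set E)
  have hbf : b.Finite := Q.finite_toSet.subset hbQ
  lift b to Finset E using hbf
  rw [← hspan, finrank_span_finset_eq_card hb]
  have hb' : LinearIndepOn ℝ id (b : Set E) := hb
  have h1 : Disjoint b (-b) := by
    rw [Finset.disjoint_left]
    intro x hx hx'
    exact hb'.add_ne_zero hx (by simpa using hx' : -x ∈ (b : Set E)) (by simp)
  have h2 : (0 : E) ∉ b ∪ -b := by
    have : (0 : E) ∉ b := fun h => hb'.ne_zero h rfl
    simpa using this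
  have h3 : insert 0 (b ∪ -b) ⊆ Q ∪ -Q := by
    have : b ⊆ Q := by exact_mod_cast hbQ
    refine Finset.insert_subset (by simp [h0]) ?_
    exact Finset.union_subset_union this (Finset.neg_subset_neg this)
  have h4 := Finset.card_le_card h3
  rw [Finset.card_insert_of_notMem h2, Finset.card_union_of_disjoint h1, Finset.card_neg] at h4
  omega

theorem vectorSpan_image_linearMap {F : Type*} [AddCommGroup F] [Module ℝ F] (f : E →ₗ[ℝ] F)
    (s : Finset E) :
    vectorSpan ℝ ((s.image f : Finset F) : Set F) = (vectorSpan ℝ (s : Set E)).map f := by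
  rw [vectorSpan_def, vectorSpan_def, Submodule.map_span, Finset.coe_image]
  congr 1
  exact (Set.image_sub f).symm

theorem spanDim_image_mkQ_add [FiniteDimensional ℝ E] {W : Submodule ℝ E} {s : Finset E}
    (h : W ≤ vectorSpan ℝ (s : Set E)) :
    spanDim (s.image W.mkQ) + Module.finrank ℝ W = spanDim s := by
  rw [spanDim, vectorSpan_image_linearMap]
  exact finrank_map_mkQ_add h

theorem spanDim_mono [FiniteDimensional ℝ E] {s t : Finset E} (h : s ⊆ t) :
    spanDim s ≤ spanDim t :=
  Submodule.finrank_mono (vectorSpan_mono ℝ (by exact_mod_cast h))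

/-- A set `Y ⊆ X` of codimension `q` in `X` satisfies
`|±(X - Y)| ≥ |X| + (2q + 1)(|Y| - 1)`. Modulo the direction of `Y` the set `±(X - Y)` becomes
`Q ∪ -Q`, where `Q` is the translate of the image of `X` that sends `Y` to `0`; it has at least
`2q + 1` elements, and each of its fibres gains `|Y| - 1` over the corresponding part of `X`. -/
theorem card_sub_union_sub_ge [FiniteDimensional ℝ E] {X Y : Finset E} (hYX : Y ⊆ X)
    (hY : Y.Nonempty) :
    X.card + (2 * (spanDim X - spanDim Y) + 1) * (Y.card - 1) ≤ ((X - Y) ∪ (Y - X)).card := by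
  have hYcard := hY.card_pos
  obtain ⟨y₀, hy₀⟩ := hY
  set W := vectorSpan ℝ (Y : Set E) with hW
  set g : E → E ⧸ W := fun x => W.mkQ (x - y₀) with hg
  have hgY : ∀ y ∈ Y, W.mkQ y = W.mkQ y₀ := by
    intro y hy
    have : y - y₀ ∈ W := vsub_mem_vectorSpan ℝ hy hy₀
    simpa [Submodule.Quotient.eq] using this
  set Q := X.image g with hQ
  have h0 : (0 : E ⧸ W) ∈ Q := Finset.mem_image.2 ⟨y₀, hYX hy₀, by simp [hg]⟩
  have hq : Module.finrank ℝ (Submodule.span ℝ (Q : Set (E ⧸ W))) = spanDim X - spanDim Y := by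
    have h1 : Submodule.span ℝ (Q : Set (E ⧸ W)) = (vectorSpan ℝ (X : Set E)).map W.mkQ := by
      rw [vectorSpan_eq_span_image_sub (z := y₀) (by exact_mod_cast hYX hy₀), Submodule.map_span,
        hQ, Finset.coe_image, Set.image_image]
    have h2 := finrank_map_mkQ_add (W := W) (U := vectorSpan ℝ (X : Set E))
      (vectorSpan_mono ℝ (by exact_mod_cast hYX))
    rw [h1]
    have h3 : Module.finrank ℝ W = spanDim Y := rfl
    have h4 : Module.finrank ℝ (vectorSpan ℝ (X : Set E)) = spanDim X := rfl
    omega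
  have hcard := two_mul_finrank_span_lt_card_union_neg h0
  rw [hq] at hcard
  set S := (X - Y) ∪ (Y - X) with hS
  have hmaps : ∀ u ∈ S, W.mkQ u ∈ Q ∪ -Q := by
    intro u hu
    rcases Finset.mem_union.1 hu with hu | hu
    · obtain ⟨x, hx, y, hy, rfl⟩ := Finset.mem_sub.1 hu
      refine Finset.mem_union_left _ (Finset.mem_image.2 ⟨x, hx, ?_⟩)
      simp [hg, map_sub, hgY y hy]
    · obtain ⟨y, hy, x, hx, rfl⟩ := Finset.mem_sub.1 hu
      refine Finset.mem_union_right _ (Finset.mem_neg'.2 (Finset.mem_image.2 ⟨x, hx, ?_⟩))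
      simp [hg, map_sub, hgY y hy]
  have hfib : ∀ c ∈ Q ∪ -Q, (X.filter (fun x => g x = c)).card + (Y.card - 1) ≤
      (S.filter (fun u => W.mkQ u = c)).card := by
    intro c hc
    by_cases hcQ : c ∈ Q
    · obtain ⟨x, hx, hxc⟩ := Finset.mem_image.1 hcQ
      have h1 := card_add_card_le_card_sub_add_one (s := X.filter (fun x => g x = c)) (t := Y)
        ⟨x, by simp [hx, hxc]⟩ ⟨y₀, hy₀⟩
      have h2 : X.filter (fun x => g x = c) - Y ⊆ S.filter (fun u => W.mkQ u = c) := by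
        intro u hu
        obtain ⟨x, hx, y, hy, rfl⟩ := Finset.mem_sub.1 hu
        rw [Finset.mem_filter] at hx ⊢
        refine ⟨Finset.mem_union_left _ (Finset.sub_mem_sub hx.1 hy), ?_⟩
        rw [← hx.2]
        simp [hg, map_sub, hgY y hy]
      have := Finset.card_le_card h2
      omega
    -- here `c` comes only from `Y - x`, and the part of `X` over `c` is empty
    · have hc' : c ∈ -Q := (Finset.mem_union.1 hc).resolve_left hcQ
      obtain ⟨x, hx, hxc⟩ := Finset.mem_image.1 (Finset.mem_neg'.1 hc')
      have h1 : X.filter (fun x => g x = c) = ∅ := by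
        rw [Finset.filter_eq_empty_iff]
        intro z hz hzc
        exact hcQ (Finset.mem_image.2 ⟨z, hz, hzc⟩)
      have h2 : Y.image (fun y => y - x) ⊆ S.filter (fun u => W.mkQ u = c) := by
        intro u hu
        obtain ⟨y, hy, rfl⟩ := Finset.mem_image.1 hu
        rw [Finset.mem_filter]
        refine ⟨Finset.mem_union_right _ (Finset.sub_mem_sub hy hx), ?_⟩
        have : c = -g x := by rw [hxc, neg_neg]
        simp [this, hg, map_sub, hgY y hy]
      have := Finset.card_le_card h2
      rw [Finset.card_image_of_injective _ (sub_left_injective)] at this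
      rw [h1, Finset.card_empty]
      omega
  rw [Finset.card_eq_sum_card_fiberwise hmaps]
  refine le_trans ?_ (Finset.sum_le_sum hfib)
  rw [Finset.sum_add_distrib, Finset.sum_const, smul_eq_mul, ← Finset.card_eq_sum_card_fiberwise
    (fun x hx => Finset.mem_coe.2 (Finset.mem_union_left _ (Finset.mem_image_of_mem g hx)))]
  gcongr

/-! ### Projections with weighted fibres -/

/-- The greedy basis for a weight `a`: one independent family `B` whose part of weight at least `t`
spans every level set `{x ∈ X | t ≤ a x}` simultaneously. -/
theorem exists_linearIndepOn_greedy {ι F : Type*} [AddCommGroup F] [Module ℝ F]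
    (X : Finset ι) (a : ι → ℕ) (f : ι → F) :
    ∃ B ⊆ X, LinearIndepOn ℝ f (B : Set ι) ∧
      ∀ x ∈ X, f x ∈ Submodule.span ℝ (f '' {y | y ∈ B ∧ a x ≤ a y}) := by
  induction X using Finset.induction_on_min_value a with
  | empty => exact ⟨∅, by simp, by simp, by simp⟩
  | insert x s hx hmin ih =>
    obtain ⟨B, hBs, hB, hspan⟩ := ih
    by_cases hfx : f x ∈ Submodule.span ℝ (f '' (B : Set ι))
    · refine ⟨B, hBs.trans (Finset.subset_insert _ _), hB, ?_⟩
      intro z hz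
      rcases Finset.mem_insert.1 hz with rfl | hz
      · refine Submodule.span_mono (Set.image_mono ?_) hfx
        exact fun y hy => ⟨hy, hmin y (hBs hy)⟩
      · exact hspan z hz
    · refine ⟨insert x B, Finset.insert_subset_insert x hBs, ?_, ?_⟩
      · rw [Finset.coe_insert]
        exact hB.insert hfx
      · intro z hz
        rcases Finset.mem_insert.1 hz with rfl | hz
        · exact Submodule.subset_span ⟨z, ⟨Finset.mem_insert_self _ _, le_rfl⟩, rfl⟩
        · refine Submodule.span_mono (Set.image_mono ?_) (hspan z hz)
          exact fun y hy => ⟨Finset.mem_insert_of_mem hy.1, hy.2⟩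

section Transversal

variable {W : Submodule ℝ E} {Z C : Finset E} {z₀ : E}

/-- If `Z` lies in the coset `z₀ + W` and `C - z₀` is independent modulo `W`, then no difference
between `Z` and `C` lies in `W`. -/
theorem notMem_of_mem_sub_union_sub (hZ : ∀ z ∈ Z, z - z₀ ∈ W)
    (hC : LinearIndepOn ℝ (fun y => W.mkQ (y - z₀)) (C : Set E)) {u : E}
    (hu : u ∈ (Z - C) ∪ (C - Z)) : u ∉ W := by
  have key : ∀ z ∈ Z, ∀ y ∈ C, z - y ∉ W := by
    intro z hz y hy h
    refine hC.ne_zero (Finset.mem_coe.2 hy) ?_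
    rw [Submodule.mkQ_apply, Submodule.Quotient.mk_eq_zero]
    have := W.sub_mem (hZ z hz) h
    rwa [sub_sub_sub_cancel_left] at this
  rcases Finset.mem_union.1 hu with hu | hu
  · obtain ⟨z, hz, y, hy, rfl⟩ := Finset.mem_sub.1 hu
    exact key z hz y hy
  · obtain ⟨y, hy, z, hz, rfl⟩ := Finset.mem_sub.1 hu
    rw [← W.neg_mem_iff, neg_sub]
    exact key z hz y hy

/-- If `Z` lies in the coset `z₀ + W` and `C - z₀` is independent modulo `W`, then all the
differences `±(z - c)` are distinct. -/
theorem card_sub_union_sub_eq (hZ : ∀ z ∈ Z, z - z₀ ∈ W)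
    (hC : LinearIndepOn ℝ (fun y => W.mkQ (y - z₀)) (C : Set E)) :
    ((Z - C) ∪ (C - Z)).card = 2 * (Z.card * C.card) := by
  set g : E → E ⧸ W := fun y => W.mkQ (y - z₀) with hg
  have hproj : ∀ z ∈ Z, ∀ y ∈ C, W.mkQ (z - y) = -g y := by
    intro z hz y _
    have h0 : W.mkQ (z - z₀) = 0 := by
      rw [Submodule.mkQ_apply, Submodule.Quotient.mk_eq_zero]; exact hZ z hz
    rw [← sub_sub_sub_cancel_right z y z₀, map_sub, h0, zero_sub]
  have hcard : (Z - C).card = Z.card * C.card := by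
    refine Finset.card_image₂_iff.2 ?_
    rintro ⟨z, y⟩ ⟨hz, hy⟩ ⟨z', y'⟩ ⟨hz', hy'⟩ h
    simp only at h hz hy hz' hy'
    have h1 : g y = g y' := by
      rw [← neg_inj, ← hproj z hz y hy, ← hproj z' hz' y' hy', h]
    have h2 : y = y' := hC.injOn hy hy' h1
    subst h2
    simpa using h
  have hdisj : Disjoint (Z - C) (C - Z) := by
    rw [Finset.disjoint_left]
    intro u hu hu'
    obtain ⟨z, hz, y, hy, rfl⟩ := Finset.mem_sub.1 hu
    obtain ⟨y', hy', z', hz', h⟩ := Finset.mem_sub.1 hu'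
    refine hC.add_ne_zero (Finset.mem_coe.2 hy) (Finset.mem_coe.2 hy') ?_
    have h1 := hproj z hz y hy
    have h2 := hproj z' hz' y' hy'
    rw [← neg_sub, h, map_neg, h1, neg_neg] at h2
    change g y + g y' = 0
    rw [h2, neg_add_cancel]
  rw [Finset.card_union_of_disjoint hdisj, hcard, ← neg_sub Z C, Finset.card_neg, hcard]
  ring

end Transversal

/-- The pointwise form of the layer decomposition. Let `L t` be the part of `X` of weight at least
`t`, and let `N t` be the set of differences between `L t` and the elements of `B` outside `L t`.
If `φ (x - y) ≥ a x + a y - 1`, then `φ u` pays for the following at the same time: one unit for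
`u ∈ X - X`, one for `u ∈ ±(X - L 2)`, one for `u ∈ L 2 - L 2`, and for every level `t ≥ 3` two
units if `u ∈ L t - L t` and one if `u ∈ N t`. The disjointness of `N t` from `L t - L t` at every
level is what prevents overpayment. -/
theorem sum_indicator_le {E : Type*} [AddCommGroup E] (X B : Finset E) (a φ : E → ℕ)
    (hBX : B ⊆ X) (ha : ∀ x ∈ X, 1 ≤ a x)
    (hφ : ∀ x ∈ X, ∀ y ∈ X, a x + a y ≤ φ (x - y) + 1)
    (L : ℕ → Finset E) (hL : ∀ t, L t = X.filter (fun x => t ≤ a x))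
    (N : ℕ → Finset E)
    (hN : ∀ t, N t = (L t - B.filter (fun y => a y < t)) ∪ (B.filter (fun y => a y < t) - L t))
    (hdisj : ∀ t, ∀ u ∈ N t, u ∉ L t - L t) (T : ℕ) {u : E} (hu : u ∈ X - X) :
    1 + (if u ∈ (X - L 2) ∪ (L 2 - X) then 1 else 0) + (if u ∈ L 2 - L 2 then 1 else 0) +
      ∑ t ∈ Finset.Icc 3 T, (2 * (if u ∈ L t - L t then 1 else 0) + if u ∈ N t then 1 else 0)
      ≤ φ u := by
  have memL : ∀ t x, x ∈ L t ↔ x ∈ X ∧ t ≤ a x := by intro t x; rw [hL, Finset.mem_filter]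
  -- `s` is the highest level whose difference set contains `u`
  obtain ⟨s, hs1, hs, hsmax⟩ : ∃ s, 1 ≤ s ∧ u ∈ L s - L s ∧ ∀ t, u ∈ L t - L t → t ≤ s := by
    obtain ⟨x, hx, y, hy, hxy⟩ := Finset.mem_sub.1 hu
    obtain ⟨p, hp, hpmax⟩ := Finset.exists_max_image
      ((X ×ˢ X).filter (fun p => p.1 - p.2 = u)) (fun p => min (a p.1) (a p.2))
      ⟨(x, y), by simp [hx, hy, hxy]⟩
    simp only [Finset.mem_filter, Finset.mem_product] at hp hpmax
    obtain ⟨⟨hp1, hp2⟩, hp3⟩ := hp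
    refine ⟨min (a p.1) (a p.2), le_min (ha _ hp1) (ha _ hp2), ?_, ?_⟩
    · rw [← hp3]
      exact Finset.sub_mem_sub ((memL _ _).2 ⟨hp1, min_le_left _ _⟩)
        ((memL _ _).2 ⟨hp2, min_le_right _ _⟩)
    · intro t ht
      obtain ⟨x, hx, y, hy, hxy⟩ := Finset.mem_sub.1 ht
      rw [memL] at hx hy
      exact (le_min hx.2 hy.2).trans (hpmax (x, y) ⟨⟨hx.1, hy.1⟩, hxy⟩)
  have hφs : 2 * s ≤ φ u + 1 := by
    obtain ⟨x, hx, y, hy, rfl⟩ := Finset.mem_sub.1 hs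
    rw [memL] at hx hy
    have := hφ x hx.1 y hy.1
    omega
  have hsum : ∑ t ∈ Finset.Icc 3 T,
      (2 * (if u ∈ L t - L t then 1 else 0) + if u ∈ N t then 1 else 0) ≤
      2 * (s - 2) + ((Finset.Icc 3 T).filter (fun t => u ∈ N t)).card := by
    rw [Finset.sum_add_distrib, ← Finset.mul_sum, ← Finset.card_filter, ← Finset.card_filter]
    have h1 : (Finset.Icc 3 T).filter (fun t => u ∈ L t - L t) ⊆ Finset.Icc 3 s := by
      intro t ht
      rw [Finset.mem_filter, Finset.mem_Icc] at ht
      exact Finset.mem_Icc.2 ⟨ht.1.1, hsmax t ht.2⟩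
    have h2 := Finset.card_le_card h1
    rw [Nat.card_Icc] at h2
    omega
  set R := (Finset.Icc 3 T).filter (fun t => u ∈ N t) with hR
  have h2le : u ∈ L 2 - L 2 → 2 ≤ s := hsmax 2
  rcases R.eq_empty_or_nonempty with hRe | hRne
  · rw [hRe, Finset.card_empty] at hsum
    by_cases h2 : 2 ≤ s
    · split_ifs <;> omega
    · rw [if_neg (fun h => h2 (h2le h))]
      have : u ∈ (X - L 2) ∪ (L 2 - X) → 2 ≤ φ u := by
        intro h
        rcases Finset.mem_union.1 h with h | h <;>
        · obtain ⟨x, hx, y, hy, rfl⟩ := Finset.mem_sub.1 h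
          simp only [memL] at hx hy
          first
          | have h3 := hφ x hx y hy.1
            have h4 := ha x hx
            omega
          | have h3 := hφ x hx.1 y hy
            have h4 := ha y hy
            omega
      split_ifs with h
      · have := this h; omega
      · omega
  -- `τ` is the highest level with `u ∈ N τ`, witnessed by the pair `x`, `y`
  · obtain ⟨τ, hτ, hτmax⟩ := Finset.exists_max_image R id hRne
    simp only [hR, Finset.mem_filter, Finset.mem_Icc, id] at hτ hτmax
    obtain ⟨x, hx, y, hyB, hyτ, hux⟩ : ∃ x, x ∈ L τ ∧ ∃ y ∈ B, a y < τ ∧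
        (u = x - y ∨ u = y - x) := by
      have h := hτ.2
      rw [hN] at h
      rcases Finset.mem_union.1 h with h | h
      · obtain ⟨x, hx, y, hy, rfl⟩ := Finset.mem_sub.1 h
        rw [Finset.mem_filter] at hy
        exact ⟨x, hx, y, hy.1, hy.2, Or.inl rfl⟩
      · obtain ⟨y, hy, x, hx, rfl⟩ := Finset.mem_sub.1 h
        rw [Finset.mem_filter] at hy
        exact ⟨x, hx, y, hy.1, hy.2, Or.inr rfl⟩
    rw [memL] at hx
    have hyX := hBX hyB
    have hy1 := ha y hyX
    have hφxy : a x + a y ≤ φ u + 1 := by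
      rcases hux with rfl | rfl
      · exact hφ x hx.1 y hyX
      · rw [add_comm]; exact hφ y hyX x hx.1
    -- a level below `a y` contains both `x` and `y`, so it cannot have `u` in `N t`
    have hlow : ∀ t, t ≤ a y → u ∈ L t - L t := by
      intro t ht
      have hx' : x ∈ L t := (memL _ _).2 ⟨hx.1, by omega⟩
      have hy' : y ∈ L t := (memL _ _).2 ⟨hyX, ht⟩
      rcases hux with rfl | rfl
      · exact Finset.sub_mem_sub hx' hy'
      · exact Finset.sub_mem_sub hy' hx'
    -- the pair `(x, y)` is at least as heavy as `s + a x`, since `y` alone already weighs `s`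
    have hsy : s ≤ a y := by
      by_contra! hlt
      by_cases hsτ : s ≤ τ
      · refine hdisj s u ?_ hs
        have hx' : x ∈ L s := (memL _ _).2 ⟨hx.1, by omega⟩
        have hy' : y ∈ B.filter (fun y => a y < s) := Finset.mem_filter.2 ⟨hyB, hlt⟩
        rw [hN]
        rcases hux with rfl | rfl
        · exact Finset.mem_union_left _ (Finset.sub_mem_sub hx' hy')
        · exact Finset.mem_union_right _ (Finset.sub_mem_sub hy' hx')
      · have hsub : L s ⊆ L τ := by
          intro z hz
          rw [memL] at hz ⊢
          exact ⟨hz.1, by omega⟩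
        exact hdisj τ u hτ.2 (Finset.sub_subset_sub hsub hsub hs)
    have hRsub : R ⊆ Finset.Icc (max (a y + 1) 3) τ := by
      intro t ht
      have ht' := ht
      rw [hR, Finset.mem_filter, Finset.mem_Icc] at ht'
      have hty : ¬ t ≤ a y := fun h => hdisj t u ht'.2 (hlow t h)
      exact Finset.mem_Icc.2 ⟨by omega, hτmax t ht'⟩
    have hRcard := Finset.card_le_card hRsub
    rw [Nat.card_Icc] at hRcard
    have h2 : 2 ≤ a y → 2 ≤ s := fun h => h2le (hlow 2 h)
    by_cases h3 : u ∈ L 2 - L 2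
    · have := h2le h3
      split_ifs <;> omega
    · rw [if_neg h3]
      have : a y < 2 := by
        by_contra! h
        exact h3 (hlow 2 h)
      split_ifs <;> omega

/-- A lower bound for the total size of the fibres over `X - X`, when `X` has weights `a ≥ 1` and
the fibre over `x - y` has size at least `a x + a y - 1`. Each level `t ≥ 3` contributes
`2 (dim X) |L t|`: the set `L t - L t` counted twice gives `2 (dim L t) |L t|`, and the differences
with the remaining `dim X - dim L t` elements of a greedy basis make up for the missing dimensions.
The first two levels are kept in the sharper form that the induction on the dimension needs. -/
theorem weighted_card_le [FiniteDimensional ℝ E] {X : Finset E} (hX : X.Nonempty) (a φ : E → ℕ)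
    (ha : ∀ x ∈ X, 1 ≤ a x) (hφ : ∀ x ∈ X, ∀ y ∈ X, a x + a y ≤ φ (x - y) + 1)
    (hZ : ∀ Z ⊆ X, Z.Nonempty → spanDim Z * Z.card ≤ (Z - Z).card) :
    (X - X).card +
      ((X - X.filter (fun x => 2 ≤ a x)) ∪ (X.filter (fun x => 2 ≤ a x) - X)).card +
      (X.filter (fun x => 2 ≤ a x) - X.filter (fun x => 2 ≤ a x)).card +
      2 * spanDim X * ∑ x ∈ X, (a x - 2) ≤ ∑ u ∈ X - X, φ u := by
  obtain ⟨z₀, hz₀, hmax⟩ := Finset.exists_max_image X a hX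
  obtain ⟨B, hBX, hB, hspan⟩ := exists_linearIndepOn_greedy X a (fun x => x - z₀)
  set L : ℕ → Finset E := fun t => X.filter (fun x => t ≤ a x) with hL
  set C : ℕ → Finset E := fun t => B.filter (fun y => a y < t) with hC
  set N : ℕ → Finset E := fun t => (L t - C t) ∪ (C t - L t) with hN
  have hLX : ∀ t, L t ⊆ X := fun t => Finset.filter_subset _ _
  have hCX : ∀ t, C t ⊆ X := fun t => (Finset.filter_subset _ _).trans hBX
  have hz₀L : ∀ t, (L t).Nonempty → z₀ ∈ L t := by
    rintro t ⟨x, hx⟩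
    rw [Finset.mem_filter] at hx ⊢
    exact ⟨hz₀, hx.2.trans (hmax x hx.1)⟩
  have hLW : ∀ t, (L t).Nonempty → ∀ z ∈ L t, z - z₀ ∈ vectorSpan ℝ (L t : Set E) :=
    fun t ht z hz => vsub_mem_vectorSpan ℝ hz (hz₀L t ht)
  -- the part of `B` in a level spans the level
  have hWspan : ∀ t, (L t).Nonempty → vectorSpan ℝ (L t : Set E) = Submodule.span ℝ
      ((fun x => x - z₀) '' (B.filter (fun y => t ≤ a y) : Finset E)) := by
    intro t ht
    rw [vectorSpan_eq_span_image_sub (Finset.mem_coe.2 (hz₀L t ht))]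
    apply le_antisymm
    · rw [Submodule.span_le]
      rintro _ ⟨x, hx, rfl⟩
      have hx := Finset.mem_filter.1 hx
      refine Submodule.span_mono (Set.image_mono ?_) (hspan x hx.1)
      intro y hy
      exact Finset.mem_coe.2 (Finset.mem_filter.2 ⟨hy.1, hx.2.trans hy.2⟩)
    · exact Submodule.span_mono (Set.image_mono
        (Finset.coe_subset.2 (Finset.filter_subset_filter _ hBX)))
  have hCind : ∀ t, (L t).Nonempty → LinearIndepOn ℝ
      (fun y => (vectorSpan ℝ (L t : Set E)).mkQ (y - z₀)) (C t : Set E) := by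
    intro t ht
    rw [hWspan t ht]
    have h1 : LinearIndepOn ℝ (fun x => x - z₀) (B.filter (fun y => t ≤ a y) : Set E) :=
      hB.mono (Finset.coe_subset.2 (Finset.filter_subset _ _))
    refine (h1.quotient_iff_union ?_).2 ?_
    · rw [Finset.disjoint_coe, Finset.disjoint_left]
      intro y hy hy'
      simp only [hC, Finset.mem_filter] at hy hy'
      omega
    · refine hB.mono ?_
      rw [← Finset.coe_union, Finset.coe_subset]
      exact Finset.union_subset (Finset.filter_subset _ _) (Finset.filter_subset _ _)
  have hspanDim : ∀ t, (L t).Nonempty → spanDim (L t) = (B.filter (fun y => t ≤ a y)).card := by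
    intro t ht
    have h1 : LinearIndepOn ℝ (fun x => x - z₀) (B.filter (fun y => t ≤ a y) : Finset E) :=
      hB.mono (Finset.coe_subset.2 (Finset.filter_subset _ _))
    rw [spanDim, hWspan t ht, Set.image_eq_range, finrank_span_eq_card h1]
    exact Fintype.card_coe _
  have hCcard : ∀ t, (L t).Nonempty → spanDim (L t) + (C t).card = spanDim X := by
    intro t ht
    have hL0 : L 0 = X := by simp [hL]
    have h0 := hspanDim 0 (by rw [hL0]; exact hX)
    rw [hL0] at h0
    rw [h0, hspanDim t ht]
    have := Finset.card_filter_add_card_filter_not (s := B) (fun y => t ≤ a y)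
    simpa [hC] using this
  have hdisj : ∀ t, ∀ u ∈ N t, u ∉ L t - L t := by
    intro t u hu hu'
    have ht : (L t).Nonempty := by
      obtain ⟨x, hx, _⟩ := Finset.mem_sub.1 hu'
      exact ⟨x, hx⟩
    refine notMem_of_mem_sub_union_sub (hLW t ht) (hCind t ht) hu ?_
    obtain ⟨x, hx, y, hy, rfl⟩ := Finset.mem_sub.1 hu'
    exact vsub_mem_vectorSpan ℝ hx hy
  have hNcard : ∀ t, 2 * spanDim X * (L t).card ≤ 2 * (L t - L t).card + (N t).card := by
    intro t
    rcases (L t).eq_empty_or_nonempty with ht | ht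
    · simp [ht]
    · have h1 : (N t).card = _ := card_sub_union_sub_eq (hLW t ht) (hCind t ht)
      have h2 := hZ (L t) (hLX t) ht
      rw [h1, ← hCcard t ht]
      nlinarith
  set T := a z₀ with hT
  have hpt := Finset.sum_le_sum (fun u (hu : u ∈ X - X) =>
    sum_indicator_le X B a φ hBX ha hφ L (fun _ => rfl) N (fun _ => rfl) hdisj T hu)
  refine le_trans ?_ hpt
  have hind : ∀ S ⊆ X - X, ∑ u ∈ X - X, (if u ∈ S then 1 else 0) = S.card := by
    intro S hS
    rw [← Finset.card_filter, Finset.filter_mem_eq_inter, Finset.inter_eq_right.2 hS]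
  have hsub : ∀ {S S' : Finset E}, S ⊆ X → S' ⊆ X → S - S' ⊆ X - X :=
    fun h h' => Finset.sub_subset_sub h h'
  rw [Finset.sum_add_distrib, Finset.sum_add_distrib, Finset.sum_add_distrib, Finset.sum_const,
    smul_eq_mul, mul_one, hind _ (hsub (hLX 2) (hLX 2)),
    hind _ (Finset.union_subset (hsub subset_rfl (hLX 2)) (hsub (hLX 2) subset_rfl)),
    Finset.sum_comm]
  have hlayer : 2 * spanDim X * ∑ x ∈ X, (a x - 2) ≤ ∑ t ∈ Finset.Icc 3 T,
      ∑ u ∈ X - X, (2 * (if u ∈ L t - L t then 1 else 0) + if u ∈ N t then 1 else 0) := by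
    have h1 : ∑ x ∈ X, (a x - 2) = ∑ t ∈ Finset.Icc 3 T, (L t).card := by
      simp only [hL, Finset.card_filter]
      rw [Finset.sum_comm]
      refine Finset.sum_congr rfl (fun x hx => ?_)
      rw [← Finset.card_filter]
      have : (Finset.Icc 3 T).filter (fun t => t ≤ a x) = Finset.Icc 3 (a x) := by
        ext t
        have := hmax x hx
        simp only [Finset.mem_filter, Finset.mem_Icc]
        omega
      rw [this, Nat.card_Icc]
      omega
    rw [h1, Finset.mul_sum]
    refine Finset.sum_le_sum (fun t _ => ?_)
    rw [Finset.sum_add_distrib, ← Finset.mul_sum, hind _ (hsub (hLX t) (hLX t)),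
      hind _ (Finset.union_subset (hsub (hLX t) (hCX t)) (hsub (hCX t) (hLX t)))]
    exact hNcard t
  simp only [hL] at hlayer ⊢
  omega

/-- The weighted bound applied to a projection: `X` is the image of `A` in `E ⧸ W`, the weight `a c`
is the number of points of `A` over `c`, and `X₂` is the set of points of weight at least `2`. -/
theorem sum_card_fiber_le_card_sub [FiniteDimensional ℝ E] {A : Finset E} (hA : A.Nonempty)
    (W : Submodule ℝ E) {X X₂ : Finset (E ⧸ W)} {a : E ⧸ W → ℕ}
    (hX : X = A.image W.mkQ) (ha : a = fun c => (A.filter (fun x => W.mkQ x = c)).card)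
    (hX₂ : X₂ = X.filter (fun x => 2 ≤ a x))
    (hZ : ∀ Z ⊆ X, Z.Nonempty → spanDim Z * Z.card ≤ (Z - Z).card) :
    (X - X).card + ((X - X₂) ∪ (X₂ - X)).card + (X₂ - X₂).card +
      2 * spanDim X * ∑ x ∈ X, (a x - 2) ≤ (A - A).card := by
  set φ : E ⧸ W → ℕ := fun u => ((A - A).filter (fun v => W.mkQ v = u)).card with hφ
  have hfne : ∀ c ∈ X, (A.filter (fun x => W.mkQ x = c)).Nonempty := by
    intro c hc
    rw [hX] at hc
    obtain ⟨x, hx, hxc⟩ := Finset.mem_image.1 hc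
    exact ⟨x, Finset.mem_filter.2 ⟨hx, hxc⟩⟩
  have hmaps : ∀ v ∈ A - A, W.mkQ v ∈ X - X := by
    intro v hv
    obtain ⟨x, hx, y, hy, rfl⟩ := Finset.mem_sub.1 hv
    rw [map_sub, hX]
    exact Finset.sub_mem_sub (Finset.mem_image_of_mem _ hx) (Finset.mem_image_of_mem _ hy)
  rw [Finset.card_eq_sum_card_fiberwise hmaps, hX₂]
  refine weighted_card_le (by rw [hX]; exact hA.image _) a φ ?_ ?_ hZ
  · intro c hc
    rw [ha]
    exact (hfne c hc).card_pos
  · intro c hc c' hc'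
    have h1 := card_add_card_le_card_sub_add_one (hfne c hc) (hfne c' hc')
    have h2 : A.filter (fun x => W.mkQ x = c) - A.filter (fun x => W.mkQ x = c') ⊆
        (A - A).filter (fun v => W.mkQ v = c - c') := by
      intro v hv
      obtain ⟨x, hx, y, hy, rfl⟩ := Finset.mem_sub.1 hv
      rw [Finset.mem_filter] at hx hy ⊢
      exact ⟨Finset.sub_mem_sub hx.1 hy.1, by rw [map_sub, hx.2, hy.2]⟩
    have := Finset.card_le_card h2
    simp only [ha, hφ]
    omega

/-! ### Sets with one line in each direction -/

/-- A nonempty finite set is not invariant under a nonzero translation: compare the sums of the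
elements. -/
theorem card_filter_sub_mem_lt {T : Finset E} (hT : T.Nonempty) {v : E} (hv : v ≠ 0) :
    (T.filter (fun p => p - v ∈ T)).card < T.card := by
  refine Finset.card_lt_card (Finset.filter_ssubset.2 ?_)
  by_contra! h
  have h1 : T.image (fun p => p - v) = T := by
    refine Finset.eq_of_subset_of_card_le ?_ ?_
    · intro u hu
      obtain ⟨p, hp, rfl⟩ := Finset.mem_image.1 hu
      exact h p hp
    · rw [Finset.card_image_of_injective _ sub_left_injective]
  have h2 : ∑ p ∈ T, (p - v) = ∑ p ∈ T, p := by
    conv_rhs => rw [← h1]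
    rw [Finset.sum_image (fun _ _ _ _ hxy => sub_left_injective hxy)]
  rw [Finset.sum_sub_distrib, sub_eq_self, Finset.sum_const, ← Nat.cast_smul_eq_nsmul ℝ,
    smul_eq_zero_iff_left hv, Nat.cast_eq_zero, Finset.card_eq_zero] at h2
  exact hT.ne_empty h2

/-- The bound `|A - A| ≥ (dim A) |A| + 1` for a set in which every direction of a difference is
represented on one line only. Weigh a pair `(x, y)` by the reciprocal of the number of
representations of `x - y`, so that the weights add up to `|A - A| - 1`. Through each `x` there are
at least `dim A` lines that contain another point of `A`, and the pairs on each such line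
have total weight at least `1`, because a nonzero difference has at most `|ℓ| - 1` representations
on a line `ℓ`. -/
theorem spanDim_mul_card_lt_of_lines {A : Finset E} (hA : A.Nonempty)
    (hlines : ∀ x ∈ A, ∀ y ∈ A, ∀ p ∈ A, ∀ q ∈ A, x ≠ y → p ≠ q →
      p - q ∈ Submodule.span ℝ {x - y} → p - x ∈ Submodule.span ℝ {x - y}) :
    spanDim A * A.card + 1 ≤ (A - A).card := by
  set r : E → ℕ := fun v => ((A ×ˢ A).filter (fun p => p.1 - p.2 = v)).card with hr
  set G : E → ℚ := fun v => if v = 0 then 0 else 1 / (r v : ℚ) with hG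
  have hG0 : ∀ v, 0 ≤ G v := by
    intro v
    simp only [hG]
    split_ifs <;> positivity
  have hrpos : ∀ x ∈ A, ∀ y ∈ A, 0 < r (x - y) := by
    intro x hx y hy
    exact Finset.card_pos.2 ⟨(x, y), by simp [hx, hy]⟩
  have htotal : ∑ x ∈ A, ∑ y ∈ A, G (x - y) = (A - A).card - 1 := by
    rw [← Finset.sum_product' A A (fun x y => G (x - y))]
    have hmaps : ∀ p ∈ A ×ˢ A, p.1 - p.2 ∈ A - A := by
      intro p hp
      rw [Finset.mem_product] at hp
      exact Finset.sub_mem_sub hp.1 hp.2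
    rw [← Finset.sum_fiberwise_of_maps_to hmaps]
    have h1 : ∀ v ∈ A - A, ∑ p ∈ (A ×ˢ A).filter (fun p => p.1 - p.2 = v), G (p.1 - p.2) =
        if v = 0 then 0 else 1 := by
      intro v hv
      rw [Finset.sum_congr rfl (fun p hp => by rw [(Finset.mem_filter.1 hp).2]),
        Finset.sum_const, nsmul_eq_mul]
      obtain ⟨x, hx, y, hy, rfl⟩ := Finset.mem_sub.1 hv
      have : (r (x - y) : ℚ) ≠ 0 := by exact_mod_cast (hrpos x hx y hy).ne'
      simp only [hG]
      split_ifs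
      · simp
      · exact mul_one_div_cancel this
    rw [Finset.sum_congr rfl h1]
    obtain ⟨x, hx⟩ := hA
    have h0 : (0 : E) ∈ A - A := by
      rw [← sub_self x]; exact Finset.sub_mem_sub hx hx
    have h2 : ∀ v, (if v = (0 : E) then (0 : ℚ) else 1) = 1 - if v = 0 then 1 else 0 := by
      intro v; split_ifs <;> simp
    simp only [h2]
    rw [Finset.sum_sub_distrib, Finset.sum_ite_eq' (A - A) (0 : E), if_pos h0]
    simp
  have hlocal : ∀ x ∈ A, (spanDim A : ℚ) ≤ ∑ y ∈ A, G (x - y) := by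
    intro x hx
    obtain ⟨b, hbA, hspan, hb⟩ :=
      exists_linearIndependent ℝ ((A.image (fun y => y - x) : Finset E) : Set E)
    have hbf : b.Finite := (Finset.finite_toSet _).subset hbA
    lift b to Finset E using hbf
    have hbcard : spanDim A = b.card := by
      rw [← finrank_span_finset_eq_card hb, hspan, spanDim,
        vectorSpan_eq_span_image_sub (Finset.mem_coe.2 hx), Finset.coe_image]
    have hb' : LinearIndepOn ℝ id (b : Set E) := hb
    set L : E → Finset E := fun w => A.filter (fun y => y ≠ x ∧ y - x ∈ Submodule.span ℝ {w})
      with hL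
    -- `L w` is the line through `x` with direction `w`, without `x` itself
    have hLdisj : (b : Set E).PairwiseDisjoint L := by
      intro w hw w' hw' hne
      rw [Function.onFun, Finset.disjoint_left]
      intro y hy hy'
      simp only [hL, Finset.mem_filter, Submodule.mem_span_singleton] at hy hy'
      obtain ⟨_, hyx, c, hc⟩ := hy
      obtain ⟨_, _, c', hc'⟩ := hy'
      have h1 := (LinearIndepOn.pair_iff id hne).1
        (hb'.mono (Set.insert_subset hw (by simpa using hw'))) c (-c')
        (by simp [hc, hc'])
      rw [h1.1, zero_smul] at hc
      exact hyx (sub_eq_zero.1 hc.symm)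
    have hLsum : ∀ w ∈ b, (1 : ℚ) ≤ ∑ y ∈ L w, G (x - y) := by
      intro w hw
      have hw0 : w ≠ 0 := hb'.ne_zero hw
      obtain ⟨y₀, hy₀, hy₀w⟩ := Finset.mem_image.1 (Finset.mem_coe.1 (hbA hw))
      have hLne : (L w).Nonempty := by
        refine ⟨y₀, Finset.mem_filter.2 ⟨hy₀, ?_, ?_⟩⟩
        · rintro rfl
          exact hw0 (by rw [← hy₀w, sub_self])
        · rw [hy₀w]; exact Submodule.mem_span_singleton_self w
      have hrle : ∀ y ∈ L w, r (x - y) ≤ (L w).card := by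
        intro y hy
        obtain ⟨hyA, hyx, hyw⟩ := Finset.mem_filter.1 hy
        have hxy : x - y ≠ 0 := sub_ne_zero.2 hyx.symm
        set T := insert x (L w) with hT
        have hxL : x ∉ L w := by simp [hL]
        have hTcard : T.card = (L w).card + 1 := Finset.card_insert_of_notMem hxL
        have hTmem : ∀ p ∈ A, p - x ∈ Submodule.span ℝ {w} → p ∈ T := by
          intro p hp hpw
          by_cases hpx : p = x
          · rw [hpx]; exact Finset.mem_insert_self _ _
          · exact Finset.mem_insert_of_mem (Finset.mem_filter.2 ⟨hp, hpx, hpw⟩)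
        have hvw : x - y ∈ Submodule.span ℝ {w} := by
          rw [← neg_sub]; exact Submodule.neg_mem _ hyw
        have hle : Submodule.span ℝ {x - y} ≤ Submodule.span ℝ {w} :=
          (Submodule.span_singleton_le_iff_mem _ _).2 hvw
        have hrT : r (x - y) ≤ (T.filter (fun p => p - (x - y) ∈ T)).card := by
          refine Finset.card_le_card_of_injOn Prod.fst ?_ ?_
          · rintro ⟨p, q⟩ hpq
            simp only [Finset.coe_filter, Finset.mem_product, Set.mem_ofPred_eq] at hpq
            obtain ⟨⟨hp, hq⟩, hpq⟩ := hpq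
            have hpx : p - x ∈ Submodule.span ℝ {w} := by
              refine hle (hlines x hx y hyA p hp q hq hyx.symm ?_ ?_)
              · rintro rfl
                exact hxy (by rw [← hpq, sub_self])
              · rw [hpq]; exact Submodule.mem_span_singleton_self _
            have hqx : q - x ∈ Submodule.span ℝ {w} := by
              have h3 : q - x = (p - x) - (x - y) := by rw [← hpq]; abel
              rw [h3]
              exact Submodule.sub_mem _ hpx hvw
            refine Finset.mem_coe.2 (Finset.mem_filter.2 ⟨hTmem p hp hpx, ?_⟩)
            have h4 : p - (x - y) = q := by rw [← hpq]; abel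
            rw [h4]
            exact hTmem q hq hqx
          · rintro ⟨p, q⟩ hpq ⟨p', q'⟩ hpq' h
            simp only [Finset.coe_filter, Finset.mem_product, Set.mem_ofPred_eq] at hpq hpq' h
            subst h
            have : q = q' := by
              have h5 := hpq.2.trans hpq'.2.symm
              exact sub_right_injective h5
            rw [this]
        have := card_filter_sub_mem_lt (T := T) ⟨x, Finset.mem_insert_self _ _⟩ hxy
        omega
      have hGle : ∀ y ∈ L w, 1 / ((L w).card : ℚ) ≤ G (x - y) := by
        intro y hy
        obtain ⟨hyA, hyx, _⟩ := Finset.mem_filter.1 hy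
        simp only [hG]
        rw [if_neg (sub_ne_zero.2 hyx.symm)]
        have h1 := hrpos x hx y hyA
        have h2 := hrle y hy
        apply one_div_le_one_div_of_le
        · exact_mod_cast h1
        · exact_mod_cast h2
      calc (1 : ℚ) = ∑ y ∈ L w, 1 / ((L w).card : ℚ) := by
            have : ((L w).card : ℚ) ≠ 0 := by exact_mod_cast hLne.card_pos.ne'
            rw [Finset.sum_const, nsmul_eq_mul, mul_one_div_cancel this]
        _ ≤ _ := Finset.sum_le_sum hGle
    calc (spanDim A : ℚ) = ∑ w ∈ b, (1 : ℚ) := by simp [hbcard]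
      _ ≤ ∑ w ∈ b, ∑ y ∈ L w, G (x - y) := Finset.sum_le_sum hLsum
      _ = ∑ y ∈ b.biUnion L, G (x - y) := (Finset.sum_biUnion hLdisj).symm
      _ ≤ ∑ y ∈ A, G (x - y) := by
          refine Finset.sum_le_sum_of_subset_of_nonneg ?_ (fun _ _ _ => hG0 _)
          exact Finset.biUnion_subset.2 (fun w _ => Finset.filter_subset _ _)
  have h1 := Finset.sum_le_sum hlocal
  rw [htotal, Finset.sum_const, nsmul_eq_mul] at h1
  have h2 : ((spanDim A * A.card + 1 : ℕ) : ℚ) ≤ ((A - A).card : ℕ) := by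
    push_cast
    linarith
  exact_mod_cast h2

/-! ### Difference sets of sets of given dimension -/

universe u

/-- A set `A` of dimension `d` satisfies `|A - A| ≥ d |A| + 1`. Unless every direction is
represented on one line only, project along a direction for which at least two lines contain two or
more points, and apply the induction hypothesis to the projection and to its level sets. -/
theorem spanDim_mul_card_lt_card_sub (d : ℕ) : ∀ (E : Type u) [AddCommGroup E] [Module ℝ E]
    [FiniteDimensional ℝ E] (A : Finset E), A.Nonempty → spanDim A = d →
    d * A.card + 1 ≤ (A - A).card := by
  induction d using Nat.strong_induction_on with
  | _ d ih =>
  intro E _ _ _ A hA hd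
  by_cases hlines : ∀ x ∈ A, ∀ y ∈ A, ∀ p ∈ A, ∀ q ∈ A, x ≠ y → p ≠ q →
      p - q ∈ Submodule.span ℝ {x - y} → p - x ∈ Submodule.span ℝ {x - y}
  · rw [← hd]
    exact spanDim_mul_card_lt_of_lines hA hlines
  push Not at hlines
  obtain ⟨x, hx, y, hy, p, hp, q, hq, hxy, hpq, hpqW, hpxW⟩ := hlines
  set W := Submodule.span ℝ {x - y} with hW
  set X := A.image W.mkQ with hX
  set a : E ⧸ W → ℕ := fun c => (A.filter (fun x => W.mkQ x = c)).card with ha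
  set X₂ := X.filter (fun x => 2 ≤ a x) with hX₂
  have hWle : W ≤ vectorSpan ℝ (A : Set E) :=
    (Submodule.span_singleton_le_iff_mem _ _).2 (vsub_mem_vectorSpan ℝ hx hy)
  have hdim := spanDim_image_mkQ_add hWle
  rw [finrank_span_singleton (sub_ne_zero.2 hxy), ← hX, hd] at hdim
  have hIH : ∀ Z ⊆ X, Z.Nonempty → spanDim Z * Z.card + 1 ≤ (Z - Z).card := by
    intro Z hZX hZ
    have := spanDim_mono hZX
    exact ih (spanDim Z) (by omega) _ Z hZ rfl
  have hmain := sum_card_fiber_le_card_sub hA W hX ha hX₂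
    (fun Z hZX hZ => (Nat.le_succ _).trans (hIH Z hZX hZ))
  have hmk : ∀ u v : E, W.mkQ u = W.mkQ v ↔ u - v ∈ W := by
    intro u v
    simp [Submodule.Quotient.eq]
  have hheavy : ∀ u ∈ A, ∀ v ∈ A, u ≠ v → u - v ∈ W → W.mkQ u ∈ X₂ := by
    intro u hu v hv huv h
    refine Finset.mem_filter.2 ⟨Finset.mem_image_of_mem _ hu, ?_⟩
    have : 1 < a (W.mkQ u) := Finset.one_lt_card.2
      ⟨u, Finset.mem_filter.2 ⟨hu, rfl⟩, v, Finset.mem_filter.2 ⟨hv, ((hmk u v).2 h).symm⟩, huv⟩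
    exact this
  have hxX₂ := hheavy x hx y hy hxy (Submodule.mem_span_singleton_self _)
  have hpX₂ := hheavy p hp q hq hpq hpqW
  have hne : W.mkQ p ≠ W.mkQ x := fun h => hpxW ((hmk p x).1 h)
  have hh : 1 < X₂.card := Finset.one_lt_card.2 ⟨_, hpX₂, _, hxX₂, hne⟩
  have hX₂X : X₂ ⊆ X := Finset.filter_subset _ _
  have hk : 1 ≤ spanDim X := by
    rw [Nat.one_le_iff_ne_zero]
    intro h0
    have h1 := Submodule.finrank_eq_zero.1 h0
    have h2 : W.mkQ p - W.mkQ x ∈ vectorSpan ℝ (X : Set (E ⧸ W)) :=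
      vsub_mem_vectorSpan ℝ (hX₂X hpX₂) (hX₂X hxX₂)
    rw [h1, Submodule.mem_bot, sub_eq_zero] at h2
    exact hne h2
  have hcard : A.card = X.card + X₂.card + ∑ c ∈ X, (a c - 2) := by
    rw [Finset.card_eq_sum_card_image W.mkQ A, hX₂, Finset.card_filter, Finset.card_eq_sum_ones,
      ← Finset.sum_add_distrib, ← Finset.sum_add_distrib]
    refine Finset.sum_congr rfl (fun c hc => ?_)
    obtain ⟨z, hz, hzc⟩ := Finset.mem_image.1 hc
    have : 0 < a c := Finset.card_pos.2 ⟨z, by simp [hz, ← hzc]⟩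
    change a c = _
    split_ifs <;> omega
  have hXX := hIH X subset_rfl (hA.image _)
  have hX₂X₂ := hIH X₂ hX₂X ⟨_, hxX₂⟩
  have hT := card_sub_union_sub_ge hX₂X ⟨_, hxX₂⟩
  obtain ⟨e, he⟩ := Nat.exists_eq_add_of_le (spanDim_mono hX₂X)
  obtain ⟨h, hh'⟩ := Nat.exists_eq_add_of_le hh
  have hs : (spanDim X + 1) * ∑ c ∈ X, (a c - 2) ≤ 2 * spanDim X * ∑ c ∈ X, (a c - 2) :=
    Nat.mul_le_mul_right _ (by omega)
  rw [he, Nat.add_sub_cancel_left, hh'] at hT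
  rw [hh'] at hX₂X₂ hcard
  rw [show 1 + 1 + h - 1 = h + 1 by omega] at hT
  rw [hcard, ← hdim]
  rw [he] at hs hXX hmain ⊢
  -- with `h + 2` heavy lines of codimension `e`, the two sides differ by at least `e * h`
  nlinarith [Nat.zero_le (e * h)]

/-- Dropping the first two levels of the weighted bound costs at most `4 (dim X) |X|`, where `X` is
the projection of `A`. -/
theorem two_mul_spanDim_mul_card_le {E : Type u} [AddCommGroup E] [Module ℝ E]
    [FiniteDimensional ℝ E] {A : Finset E} (hA : A.Nonempty) (W : Submodule ℝ E) :
    2 * spanDim (A.image W.mkQ) * A.card ≤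
      ((A : Set E) - (A : Set E)).ncard +
        4 * spanDim (A.image W.mkQ) * (A.image W.mkQ).card := by
  rw [← Finset.coe_sub, Set.ncard_coe_finset]
  set X := A.image W.mkQ with hX
  set a : E ⧸ W → ℕ := fun c => (A.filter (fun x => W.mkQ x = c)).card with ha
  have hmain := sum_card_fiber_le_card_sub hA W hX ha rfl
    (fun Z _ hZ => (Nat.le_succ _).trans (spanDim_mul_card_lt_card_sub _ _ Z hZ rfl))
  have hAcard : A.card ≤ 2 * X.card + ∑ c ∈ X, (a c - 2) := by
    rw [Finset.card_eq_sum_card_image W.mkQ A, mul_comm, ← smul_eq_mul, ← Finset.sum_const,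
      ← Finset.sum_add_distrib]
    refine Finset.sum_le_sum (fun c _ => ?_)
    change a c ≤ _
    omega
  calc 2 * spanDim X * A.card ≤ 2 * spanDim X * (2 * X.card + ∑ c ∈ X, (a c - 2)) := by gcongr
    _ = 2 * spanDim X * ∑ c ∈ X, (a c - 2) + 4 * spanDim X * X.card := by ring
    _ ≤ _ := by omega

end DifferenceSets

theorem proposition3p1 (d r : ℕ)
    (l : Fin r → AffineSubspace ℝ (EuclideanSpace ℝ (Fin d)))
    (hline : ∀ i, IsLine (l i))
    (hparallel : ∀ i j, (l i).Parallel (l j))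
    (A : Set (EuclideanSpace ℝ (Fin d)))
    (hfin : A.Finite) (hne : A.Nonempty) (hdim : affDim A = d)
    (hcover : A ⊆ ⋃ i, (l i : Set (EuclideanSpace ℝ (Fin d))))
    (hcard : ∀ i, 2 * d ^ 2 ≤ (A ∩ (l i : Set (EuclideanSpace ℝ (Fin d)))).ncard) :
    ((A - A).ncard : ℝ) ≥ (2 * (d : ℝ) - 2) * (A.ncard : ℝ) - 1000 * (d : ℝ) ^ 3 * (r : ℝ) := by
  classical
  lift A to Finset (EuclideanSpace ℝ (Fin d)) using hfin
  obtain ⟨z, hz⟩ := hne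
  obtain ⟨i₀, -⟩ := Set.mem_iUnion.1 (hcover hz)
  have hdimA : spanDim A = d := by
    rw [affDim, direction_affineSpan] at hdim
    exact hdim
  set W := (l i₀).direction with hW
  have hW1 : Module.finrank ℝ W = 1 := hline i₀
  have htop : vectorSpan ℝ (A : Set (EuclideanSpace ℝ (Fin d))) = ⊤ := by
    apply Submodule.eq_top_of_finrank_eq
    rw [finrank_euclideanSpace_fin]
    exact hdimA
  have hk := spanDim_image_mkQ_add (W := W) (s := A) (by rw [htop]; exact le_top)
  rw [hW1, hdimA] at hk
  have hbound := two_mul_spanDim_mul_card_le ⟨z, hz⟩ W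
  set X := A.image W.mkQ with hX
  -- each point of the projection is the image of one of the `r` lines
  have hXr : X.card ≤ r := by
    have hsub : X ⊆ (Finset.univ : Finset (Fin r)).image
        (fun i => W.mkQ (Classical.epsilon (fun p => p ∈ l i))) := by
      intro c hc
      obtain ⟨x, hx, rfl⟩ := Finset.mem_image.1 hc
      obtain ⟨i, hi⟩ := Set.mem_iUnion.1 (hcover hx)
      have hp : Classical.epsilon (fun p => p ∈ l i) ∈ l i := Classical.epsilon_spec ⟨x, hi⟩
      refine Finset.mem_image.2 ⟨i, Finset.mem_univ _, ?_⟩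
      rw [Submodule.mkQ_apply, Submodule.mkQ_apply, Submodule.Quotient.eq, hW,
        (hparallel i₀ i).direction_eq]
      exact AffineSubspace.vsub_mem_direction hp hi
    simpa using (Finset.card_le_card hsub).trans Finset.card_image_le
  rw [Set.ncard_coe_finset]
  have hkd : (d : ℝ) = spanDim X + 1 := by exact_mod_cast hk.symm
  have hbound' : 2 * (spanDim X : ℝ) * A.card ≤
      ((A : Set (EuclideanSpace ℝ (Fin d))) - A).ncard + 4 * spanDim X * X.card := by
    exact_mod_cast hbound
  have hd1 : (1 : ℝ) ≤ d := by rw [hkd]; linarith [Nat.cast_nonneg (α := ℝ) (spanDim X)]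
  have hcube : (d : ℝ) ≤ (d : ℝ) ^ 3 := le_self_pow₀ hd1 three_ne_zero
  have hkr : 4 * (spanDim X : ℝ) * X.card ≤ 1000 * (d : ℝ) ^ 3 * r :=
    mul_le_mul (by linarith) (by exact_mod_cast hXr) (by positivity) (by positivity)
  have hcoef : 2 * (d : ℝ) - 2 = 2 * spanDim X := by rw [hkd]; ring
  rw [hcoef]
  linarith
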